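/- **Setting.** Let $(P,\wedge,\vee)$ be a lattice. A finite set $S\subseteq P$ is meet closed if $x\wedge y\in S$ for all $x,y\in S$. For $f:P\to\mathbb C$ the join matrix is $[S]_f=[f(x\vee y)]_{x,y\in S}$. Let $\mu_S$ be the Möbius function of the poset $(S,\le)$, and for $z\in S$ put $(\tfrac1f *_S\mu_S)(z)=\sum_{w\in S,\,w\le z}\tfrac1{f(w)}\mu_S(w,z)$. Let $\mathcal F$ be the set of all $f:P\to\mathbb C$ with $f(x)\ne 0$ for all $x$ and $f(x)f(y)=f(x\wedge y)f(x\vee y)$ for all $x,y\in P$. Let $S=\{x_1,\dots,x_n\}$ be enumerated without repetition so that $x_i<x_j\Rightarrow i<j$, and let $m_i$ be the number of elements of $\{x_1,\dots,x_{i-1}\}$ covered by $x_i$ in the poset $\{x_1,\dots,x_i\}$. We say that $S$ is constructed by the methods $(\mathrm M_{m_1,1}),\dots,(\mathrm M_{m_n,n})$. For $k\ge1$ let $\mathcal F_k$ be the set of those $f\in\mathcal F$ such that $(\frac1f*_S\mu_S)(x_i)\neq0$ for all $i$ whenever $S$ is a finite meet closed subset of $P$ with such an enumeration for which $m_1,\dots,m_n\le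 k$. **Diagrams.** A word $A_1|A_2|\dots|A_{n-1}$ denotes the Hasse diagram on the vertices $0,\dots,n-1$ in which the vertices covered by $j$ are the digits of $A_j$, and $0$ covers nothing. A finite set $S\subseteq P$ belongs to the class given by a word if the Hasse diagram of $(S,\le)$ is this diagram, up to renaming the vertices. Consider the classes $\mathcal S_{3,5}$: 0|0|0|123; $\mathcal S_{3,6}$: 0|0|1|1|234; $\mathcal S_{3,7}$: 0|0|1|2|12|345; $\mathcal S_{4,6}$: 0|0|0|0|1234; $\mathcal S^{(1)}_{4,7}$: 0|0|1|1|1|2345; $\mathcal S^{(2)}_{4,7}$: 0|0|0|1|1|2345; $\mathcal S_{5,7}$: 0|0|0|0|0|12345. For each of them let $\mathcal G_{k,n}$ (respectively $\mathcal G_{4,7}^{(j)}$) be the set of those $f\in\mathcal F$ such that $(\frac1f*_S\mu_S)(x)\ne0$ for every meet closed $S\subseteq P$ in $\mathcal S_{k,n}$ (respectively $\mathcal S_{4,7}^{(j)}$), where $x$ is the element of $S$ that corresponds to the vertex $n-1$, that is, the greatest element of $S$. Consider further the following 47 classes. (A) $7_{\rm AA}$: 0|0|0|123|4|0, $7_{\rm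 AB}$: 0|0|0|123|4|1, $7_{\rm AC}$: 0|0|0|123|4|4, $7_{\rm AD}$: 0|0|0|123|4|5, $7_{\rm AE}$: 0|0|0|1|123|0, $7_{\rm AF}$: 0|0|0|3|123|1, $7_{\rm AG}$: 0|0|0|1|123|1, $7_{\rm AH}$: 0|0|0|1|123|4, $7_{\rm AI}$: 0|0|0|0|123|0, $7_{\rm AJ}$: 0|0|0|0|124|3, $7_{\rm AK}$: 0|1|1|1|234|0, $7_{\rm AL}$: 0|1|1|1|234|1, $7_{\rm AM}$: 0|1|1|1|234|2, $7_{\rm AN}$: 0|1|1|1|234|5, $7_{\rm AO}$: 0|0|0|2|134|0, $7_{\rm AP}$: 0|0|0|2|134|1, $7_{\rm AQ}$: 0|0|0|2|134|2, $7_{\rm AR}$: 0|0|0|2|134|4, $7_{\rm AS}$: 0|0|0|2|134|5, $7_{\rm AT}$: 0|0|0|2|4|135, $7_{\rm AU}$: 0|1|1|1|2|345, $7_{\rm AV}$: 0|1|2|2|2|345, $7_{\rm AX}$: 0|0|0|1|3|245. (B) $7_{\rm BA}$: 0|0|1|1|234|0, $7_{\rm BB}$: 0|0|1|1|234|1, $7_{\rm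 BC}$: 0|0|2|2|134|1, $7_{\rm BD}$: 0|0|2|2|134|4, $7_{\rm BE}$: 0|0|2|2|134|5, $7_{\rm BF}$: 0|0|1|3|3|245, $7_{\rm BG}$: 0|0|1|1|3|245, $7_{\rm BH}$: 0|1|1|2|2|345, $7_{\rm BI}$: 0|0|1|1|2|345. (C) $7_{\rm CA}$: 0|0|0|1|123|45, $7_{\rm CB}$: 0|0|0|0|123|45, $7_{\rm CC}$: 0|0|0|0|123|34, $7_{\rm CD}$: 0|0|0|0|12|345, $7_{\rm CE}$: 0|0|2|2|12|345. (D) $7_{\rm DA}$: 0|0|0|0|1234|0, $7_{\rm DB}$: 0|0|0|0|1234|4, $7_{\rm DC}$: 0|0|0|0|1234|5, $7_{\rm DD}$: 0|1|1|1|1|2345, $7_{\rm DE}$: 0|0|0|0|2|1345. (E) to (I) $7_{\rm E}$: 0|0|0|2|23|145, $7_{\rm F}$: 0|0|1|2|12|345, $7_{\rm G}$: 0|0|1|1|1|2345, $7_{\rm H}$: 0|0|0|1|1|2345, $7_{\rm I}$: 0|0|0|0|0|12345. **Theorem.** Let $S$ be a meet closed subset of $P$ with $7$ elements. Then $S$ can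 be constructed by methods with all $m_i\le2$ if and only if $S$ belongs to none of these 47 classes. Moreover: (i) If $S$ belongs to none of the 47 classes and $f\in\mathcal F_2$, then $[S]_f$ is invertible. (ii) If $S$ belongs to one of $7_{\rm AA},\dots,7_{\rm AX}$ and $f\in\mathcal F_1\cap\mathcal G_{3,5}$, then $[S]_f$ is invertible. (iii) If $S$ belongs to one of $7_{\rm BA},\dots,7_{\rm BI}$ and $f\in\mathcal F_1\cap\mathcal G_{3,6}$, then $[S]_f$ is invertible. (iv) If $S$ belongs to one of $7_{\rm CA},\dots,7_{\rm CE}$ and $f\in\mathcal F_2\cap\mathcal G_{3,5}$, then $[S]_f$ is invertible. (v) If $S$ belongs to one of $7_{\rm DA},\dots,7_{\rm DE}$ and $f\in\mathcal F_1\cap\mathcal G_{4,6}$, then $[S]_f$ is invertible. (vi) If $S\in7_{\rm E}$ and $f\in\mathcal F_2\cap\mathcal G_{3,6}$, then $[S]_f$ is invertible. (vii) If $S\in7_{\rm F}$ and $f\in\mathcal F_2\cap\mathcal G_{3,7}$, then $[S]_f$ is invertible. (viii) If $S\in7_{\rm G}$ and $f\in\mathcal F_1\cap\mathcal G_{4,7}^{(1)}$,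 then $[S]_f$ is invertible. (ix) If $S\in7_{\rm H}$ and $f\in\mathcal F_1\cap\mathcal G_{4,7}^{(2)}$, then $[S]_f$ is invertible. (x) If $S\in7_{\rm I}$ and $f\in\mathcal F_1\cap\mathcal G_{5,7}$, then $[S]_f$ is invertible. -/

import Mathlib

namespace JoinMatrix

section Functions

variable {P : Type*} [Lattice P]

/-- `f` is semimultiplicative: `f(x) f(y) = f(x ∧ y) f(x ∨ y)`. -/
def Semimultiplicative (f : P → ℂ) : Prop :=
  ∀ x y : P, f x * f y = f (x ⊓ y) * f (x ⊔ y)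

/-- The join matrix `[S]_f`, with entries `f(x ∨ y)` for `x, y ∈ S`. -/
def joinMatrix (S : Finset P) (f : P → ℂ) : Matrix S S ℂ :=
  Matrix.of fun x y => f ((x : P) ⊔ (y : P))

open Classical in
/-- The Möbius function `μ_S` of the finite poset `(S, ≤)`, `≤` being inherited from `P`. -/
noncomputable def moebius (S : Finset P) : IncidenceAlgebra ℂ S :=
  letI : LocallyFiniteOrder S := Fintype.toLocallyFiniteOrder
  IncidenceAlgebra.mu (α := S) ℂ

open Classical in
/-- `((1/f) *_S μ_S)(z) = ∑_{w ∈ S, w ≤ z} (1/f(w)) μ_S(w, z)` for `z ∈ S`. -/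
noncomputable def recipConv (S : Finset P) (f : P → ℂ) (z : S) : ℂ :=
  ∑ w : S with w ≤ z, 1 / f w * moebius S w z

/-- The class `F` of semimultiplicative functions without zeros. -/
def classF (P : Type*) [Lattice P] : Set (P → ℂ) :=
  {f | Semimultiplicative f ∧ ∀ x, f x ≠ 0}

end Functions

section Methods

variable {P : Type*} [Lattice P]

/-- The enumeration `x` of `S` satisfies `x i < x j → i < j`. -/
def IsLinearEnumeration {S : Finset P} {n : ℕ} (x : Fin n ≃ S) : Prop :=
  ∀ i j, x i < x j → i < j

/-- The number `m_i` of the method by which `x i` is added to `{x j | j < i}`: the number of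
elements `x j` with `j < i` which are covered by `x i` in `{x k | k ≤ i}`. -/
noncomputable def methodNumber {S : Finset P} {n : ℕ} (x : Fin n ≃ S) (i : Fin n) : ℕ :=
  Set.ncard {j : Fin n | j < i ∧ x j < x i ∧ ∀ k ≤ i, ¬ (x j < x k ∧ x k < x i)}

/-- `S` can be constructed, element by element, by methods with all numbers `m_i ≤ k`. -/
def ConstructibleWith (k : ℕ) (S : Finset P) : Prop :=
  ∃ (n : ℕ) (x : Fin n ≃ S), IsLinearEnumeration x ∧ ∀ i, methodNumber x i ≤ k

/-- The class `F_k`: all the conditions `((1/f) *_S μ_S)(x i) ≠ 0` hold whenever a meet closed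
set `S` is constructed by methods with all numbers `m_i ≤ k`. -/
def classFk (P : Type*) [Lattice P] (k : ℕ) : Set (P → ℂ) :=
  {f | f ∈ classF P ∧ ∀ S : Finset P, InfClosed (S : Set P) →
    ∀ (n : ℕ) (x : Fin n ≃ S), IsLinearEnumeration x → (∀ i, methodNumber x i ≤ k) →
      ∀ i, recipConv S f (x i) ≠ 0}

end Methods

section Diagrams

/-- A Hasse diagram on the vertices `0, …, n - 1`: `D j` lists the vertices covered by `j`. -/
abbrev HasseDiagram (n : ℕ) := Fin n → List (Fin n)

variable {P : Type*} [Lattice P]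

/-- The bijection `e` identifies `D` with the Hasse diagram of the poset `(S, ≤)`. -/
def Realizes {n : ℕ} (D : HasseDiagram n) {S : Finset P} (e : Fin n ≃ S) : Prop :=
  ∀ i j, i ∈ D j ↔ e i ⋖ e j

/-- The Hasse diagram of the poset `(S, ≤)` is `D`, up to the names of the vertices. -/
def HasDiagram {n : ℕ} (D : HasseDiagram n) (S : Finset P) : Prop :=
  ∃ e : Fin n ≃ S, Realizes D e

/-- `S` belongs to one of the structure classes given by the diagrams in `L`. -/
def InClasses {n : ℕ} (L : List (HasseDiagram n)) (S : Finset P) : Prop :=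
  ∃ D ∈ L, HasDiagram D S

/-- The class `G` of functions attached to a diagram whose last added element is its last vertex:
the condition `((1/f) *_S μ_S)(x) ≠ 0` holds for the last added element `x` of each meet closed
set `S` with this diagram. -/
def classG (P : Type*) [Lattice P] {n : ℕ} (D : HasseDiagram (n + 1)) : Set (P → ℂ) :=
  {f | f ∈ classF P ∧ ∀ S : Finset P, InfClosed (S : Set P) →
    ∀ e : Fin (n + 1) ≃ S, Realizes D e → recipConv S f (e (Fin.last n)) ≠ 0}

/-- The structure `S_{3,5}`. -/
def diagramS35 : HasseDiagram 5 :=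
  ![[], [0], [0], [0], [1, 2, 3]]

/-- The structure `S_{3,6}`. -/
def diagramS36 : HasseDiagram 6 :=
  ![[], [0], [0], [1], [1], [2, 3, 4]]

/-- The structure `S_{3,7}`. -/
def diagramS37 : HasseDiagram 7 :=
  ![[], [0], [0], [1], [2], [1, 2], [3, 4, 5]]

/-- The structure `S_{4,6}`. -/
def diagramS46 : HasseDiagram 6 :=
  ![[], [0], [0], [0], [0], [1, 2, 3, 4]]

/-- The structure `S_{4,7}^(1)`. -/
def diagramS47one : HasseDiagram 7 :=
  ![[], [0], [0], [1], [1], [1], [2, 3, 4, 5]]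

/-- The structure `S_{4,7}^(2)`. -/
def diagramS47two : HasseDiagram 7 :=
  ![[], [0], [0], [0], [1], [1], [2, 3, 4, 5]]

/-- The structure `S_{5,7}`. -/
def diagramS57 : HasseDiagram 7 :=
  ![[], [0], [0], [0], [0], [0], [1, 2, 3, 4, 5]]

/-- The structures `7_AA`, …, `7_AX`. -/
def diagrams7A : List (HasseDiagram 7) :=
  [ ![[], [0], [0], [0], [1, 2, 3], [4], [0]],
    ![[], [0], [0], [0], [1, 2, 3], [4], [1]],
    ![[], [0], [0], [0], [1, 2, 3], [4], [4]],
    ![[], [0], [0], [0], [1, 2, 3], [4], [5]],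
    ![[], [0], [0], [0], [1], [1, 2, 3], [0]],
    ![[], [0], [0], [0], [3], [1, 2, 3], [1]],
    ![[], [0], [0], [0], [1], [1, 2, 3], [1]],
    ![[], [0], [0], [0], [1], [1, 2, 3], [4]],
    ![[], [0], [0], [0], [0], [1, 2, 3], [0]],
    ![[], [0], [0], [0], [0], [1, 2, 4], [3]],
    ![[], [0], [1], [1], [1], [2, 3, 4], [0]],
    ![[], [0], [1], [1], [1], [2, 3, 4], [1]],
    ![[], [0], [1], [1], [1], [2, 3, 4], [2]],
    ![[], [0], [1], [1], [1], [2, 3, 4], [5]],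
    ![[], [0], [0], [0], [2], [1, 3, 4], [0]],
    ![[], [0], [0], [0], [2], [1, 3, 4], [1]],
    ![[], [0], [0], [0], [2], [1, 3, 4], [2]],
    ![[], [0], [0], [0], [2], [1, 3, 4], [4]],
    ![[], [0], [0], [0], [2], [1, 3, 4], [5]],
    ![[], [0], [0], [0], [2], [4], [1, 3, 5]],
    ![[], [0], [1], [1], [1], [2], [3, 4, 5]],
    ![[], [0], [1], [2], [2], [2], [3, 4, 5]],
    ![[], [0], [0], [0], [1], [3], [2, 4, 5]] ]

/-- The structures `7_BA`, …, `7_BI`. -/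
def diagrams7B : List (HasseDiagram 7) :=
  [ ![[], [0], [0], [1], [1], [2, 3, 4], [0]],
    ![[], [0], [0], [1], [1], [2, 3, 4], [1]],
    ![[], [0], [0], [2], [2], [1, 3, 4], [1]],
    ![[], [0], [0], [2], [2], [1, 3, 4], [4]],
    ![[], [0], [0], [2], [2], [1, 3, 4], [5]],
    ![[], [0], [0], [1], [3], [3], [2, 4, 5]],
    ![[], [0], [0], [1], [1], [3], [2, 4, 5]],
    ![[], [0], [1], [1], [2], [2], [3, 4, 5]],
    ![[], [0], [0], [1], [1], [2], [3, 4, 5]] ]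

/-- The structures `7_CA`, …, `7_CE`. -/
def diagrams7C : List (HasseDiagram 7) :=
  [ ![[], [0], [0], [0], [1], [1, 2, 3], [4, 5]],
    ![[], [0], [0], [0], [0], [1, 2, 3], [4, 5]],
    ![[], [0], [0], [0], [0], [1, 2, 3], [3, 4]],
    ![[], [0], [0], [0], [0], [1, 2], [3, 4, 5]],
    ![[], [0], [0], [2], [2], [1, 2], [3, 4, 5]] ]

/-- The structures `7_DA`, …, `7_DE`. -/
def diagrams7D : List (HasseDiagram 7) :=
  [ ![[], [0], [0], [0], [0], [1, 2, 3, 4], [0]],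
    ![[], [0], [0], [0], [0], [1, 2, 3, 4], [4]],
    ![[], [0], [0], [0], [0], [1, 2, 3, 4], [5]],
    ![[], [0], [1], [1], [1], [1], [2, 3, 4, 5]],
    ![[], [0], [0], [0], [0], [2], [1, 3, 4, 5]] ]

/-- The structure `7_E`. -/
def diagrams7E : List (HasseDiagram 7) :=
  [ ![[], [0], [0], [0], [2], [2, 3], [1, 4, 5]] ]

/-- The structure `7_F`. -/
def diagrams7F : List (HasseDiagram 7) :=
  [ ![[], [0], [0], [1], [2], [1, 2], [3, 4, 5]] ]

/-- The structure `7_G`. -/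
def diagrams7G : List (HasseDiagram 7) :=
  [ ![[], [0], [0], [1], [1], [1], [2, 3, 4, 5]] ]

/-- The structure `7_H`. -/
def diagrams7H : List (HasseDiagram 7) :=
  [ ![[], [0], [0], [0], [1], [1], [2, 3, 4, 5]] ]

/-- The structure `7_I`. -/
def diagrams7I : List (HasseDiagram 7) :=
  [ ![[], [0], [0], [0], [0], [0], [1, 2, 3, 4, 5]] ]

/-- All the 47 structures. -/
def diagrams7 : List (HasseDiagram 7) :=
  diagrams7A ++ diagrams7B ++ diagrams7C ++ diagrams7D ++ diagrams7E ++ diagrams7F ++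
    diagrams7G ++ diagrams7H ++ diagrams7I

end Diagrams

end JoinMatrix

open JoinMatrix

/-! Semimultiplicativity gives f(x ∨ y) = f(x) f(y) / f(x ∧ y), and Möbius inversion on the meet
closed set S writes 1 / f(x ∧ y) as the sum of `recipConv S f w` over the common lower bounds w of x
and y in S. Hence the join matrix factors as Δ E D Eᵀ Δ, where E is the zeta matrix, Δ is the
diagonal of f and D that of `recipConv S f`, and it is invertible once `recipConv S f` has no zero
(`isUnit_joinMatrix`).

The value of `recipConv` at z is local: S may be replaced by any meet closed subset containing z and
all that z covers (`recipConv_eq_of_subset`). If z covers at most one or two elements, a chain or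
the set {z, a, b, a ∧ b} suffices, and `classFk` applies. Otherwise one of the special structures is
found around z, a finite check on each diagram (`recipConv_ne_zero_of_isSubdiagram`).

The method numbers merely count covered elements (`methodNumber_eq_ncard`). So the classification
says that the 47 diagrams are those of the seven-element meet semilattices with an element covering
at least three others. A linear extension codes each element by the bit mask of its down-set, meets
become bitwise conjunctions, and the kernel runs through all cases (`classifiedBelow_of_lt`). -/

namespace JoinMatrix

/-! ### Möbius inversion, locality of the convolution, and factorization of the join matrix. -/

section Convolution

variable {P : Type*} [Lattice P]

open Classical in
theorem sum_recipConv (S : Finset P) (f : P → ℂ) (z : S) :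
    ∑ w : S with w ≤ z, recipConv S f w = 1 / f z := by
  let : LocallyFiniteOrder S := Fintype.toLocallyFiniteOrder
  have key : ∀ u : S, ∑ w : S with u ≤ w ∧ w ≤ z, moebius S u w = if u = z then 1 else 0 := by
    intro u
    rw [← IncidenceAlgebra.sum_Icc_mu_right (𝕜 := ℂ) u z]
    refine Finset.sum_congr ?_ fun _ _ => rfl
    ext w
    simp
  simp only [recipConv]
  rw [Finset.sum_comm' (t' := Finset.univ) (s' := fun u => {w : S | u ≤ w ∧ w ≤ z})
    (by intro x y; simp [and_comm])]
  simp only [← Finset.mul_sum, key]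
  simp

open Classical in
-- Uniqueness in Möbius inversion. It serves both to identify `recipConv` on a subset and to invert
-- the zeta matrix.
theorem eq_of_sum_le_eq {S : Finset P} {g h : S → ℂ}
    (H : ∀ z : S, ∑ w : S with w ≤ z, g w = ∑ w : S with w ≤ z, h w) : g = h := by
  funext z
  induction z using WellFoundedLT.induction with
  | ind z ih =>
    have hz : ({w : S | w ≤ z} : Finset S) = insert z ({w : S | w < z} : Finset S) := by
      ext w
      simp [le_iff_eq_or_lt]
    have := H z
    rw [hz, Finset.sum_insert (by simp), Finset.sum_insert (by simp),
      Finset.sum_congr rfl fun w hw => ih w (by simpa using hw)] at this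
    exact add_right_cancel this

open Classical in
theorem exists_isLeast_ge {T : Finset P} (hT : InfClosed (T : Set P)) {w : P} {t : T}
    (h : w ≤ t) : ∃ u : T, w ≤ u ∧ ∀ t' : T, w ≤ t' → u ≤ t' := by
  have hne : (T.filter (w ≤ ·)).Nonempty := ⟨t, by simp [h]⟩
  have hm : (T.filter (w ≤ ·)).inf' hne id ∈ (T : Set P) :=
    hT.finsetInf'_mem hne fun i hi => (Finset.mem_filter.1 hi).1
  refine ⟨⟨_, hm⟩, ?_, ?_⟩
  · exact Finset.le_inf' hne _ fun i hi => (Finset.mem_filter.1 hi).2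
  · intro t' ht'
    exact Finset.inf'_le (f := id) (b := (t' : P)) (by simp [ht'])

/-- `recipConv S f z` depends only on `z`, the elements covered by `z` and their meets. -/
theorem recipConv_eq_of_subset {S T : Finset P} (hT : InfClosed (T : Set P)) (hTS : T ⊆ S)
    (f : P → ℂ) {z : P} (hz : z ∈ T) (hcov : ∀ w : S, w ⋖ ⟨z, hTS hz⟩ → (w : P) ∈ T) :
    recipConv T f ⟨z, hz⟩ = recipConv S f ⟨z, hTS hz⟩ := by
  classical
  -- Each w in S lying below some element of T has a least element of T above it. Grouping the
  -- values of `recipConv S f` by that element gives a function on T with the same down-set sums as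
  -- `recipConv T f`.
  let h : T → ℂ := fun t => Finset.sum (Finset.filter
    (fun w : S => (w : P) ≤ t ∧ ∀ t' : T, (w : P) ≤ t' → t ≤ t') Finset.univ)
    fun w : S => recipConv S f w
  have hh : recipConv T f = h := by
    refine eq_of_sum_le_eq fun t => ?_
    rw [sum_recipConv]
    have h1 : 1 / f t = ∑ w : S with w ≤ ⟨t, hTS t.2⟩, recipConv S f w :=
      (sum_recipConv S f ⟨t, hTS t.2⟩).symm
    rw [h1]
    simp only [h, Finset.sum_filter]
    simp only [← Finset.sum_filter]
    simp only [Finset.sum_filter (s := (Finset.univ : Finset S))]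
    rw [Finset.sum_comm]
    refine Finset.sum_congr rfl fun w _ => ?_
    by_cases hw : (w : P) ≤ t
    · obtain ⟨u, hu, hu'⟩ := exists_isLeast_ge hT hw
      rw [if_pos (show w ≤ (⟨t, hTS t.2⟩ : S) from hw), Finset.sum_eq_single u]
      · rw [if_pos ⟨hu, hu'⟩]
      · intro b _ hb
        exact if_neg fun hc => hb (le_antisymm (hc.2 u hu) (hu' b hc.1))
      · intro hc
        exact (hc (Finset.mem_filter.2 ⟨Finset.mem_univ _, hu' t hw⟩)).elim
    · rw [if_neg (show ¬ w ≤ (⟨t, hTS t.2⟩ : S) from hw)]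
      refine (Finset.sum_eq_zero fun u hu => if_neg fun hc => hw ?_).symm
      exact hc.1.trans (Finset.mem_filter.1 hu).2
  rw [hh]
  -- The group of z is just {z}: any w < z lies below an element covered by z, and that element is
  -- in T.
  have : ({w : S | (w : P) ≤ z ∧ ∀ t' : T, (w : P) ≤ t' → (⟨z, hz⟩ : T) ≤ t'} : Finset S) =
      {⟨z, hTS hz⟩} := by
    ext w
    simp only [Finset.mem_filter, Finset.mem_univ, true_and, Finset.mem_singleton]
    constructor
    · rintro ⟨h1, h2⟩
      by_contra hne
      have hlt : w < (⟨z, hTS hz⟩ : S) := lt_of_le_of_ne h1 hne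
      obtain ⟨u, hu, hu'⟩ := exists_le_covBy_of_lt hlt
      exact (hu'.lt.not_ge : ¬ (⟨z, hTS hz⟩ : S) ≤ u) (h2 ⟨u, hcov u hu'⟩ hu)
    · rintro rfl
      exact ⟨le_rfl, fun _ h => h⟩
  simp only [h]
  rw [this, Finset.sum_singleton]

theorem isUnit_joinMatrix [DecidableEq P] {S : Finset P} (hS : InfClosed (S : Set P)) {f : P → ℂ}
    (hf : f ∈ classF P) (h : ∀ z : S, recipConv S f z ≠ 0) : IsUnit (joinMatrix S f) := by
  classical
  let E : Matrix S S ℂ := Matrix.of fun x w => if w ≤ x then 1 else 0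
  have hE : IsUnit E := by
    rw [← Matrix.mulVec_injective_iff_isUnit]
    intro g g' hgg
    refine eq_of_sum_le_eq fun z => ?_
    have := congrFun hgg z
    simpa [Matrix.mulVec, dotProduct, E, Finset.sum_filter] using this
  have hd : ∀ g : S → ℂ, (∀ z, g z ≠ 0) → IsUnit (Matrix.diagonal g) := by
    intro g hg
    rw [Matrix.isUnit_diagonal, Pi.isUnit_iff]
    exact fun z => (hg z).isUnit
  have hET : IsUnit E.transpose := by
    rwa [Matrix.isUnit_transpose]
  have hfac : joinMatrix S f = Matrix.diagonal (fun x : S => f x) *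
      (E * Matrix.diagonal (recipConv S f) * E.transpose) *
      Matrix.diagonal (fun x : S => f x) := by
    ext x y
    rw [Matrix.mul_diagonal, Matrix.diagonal_mul, Matrix.mul_apply]
    simp only [Matrix.mul_diagonal, Matrix.transpose_apply, E, Matrix.of_apply, joinMatrix]
    have hs := sum_recipConv S f ⟨(x : P) ⊓ y, hS x.2 y.2⟩
    have : ∑ w : S, (if w ≤ x then 1 else 0) * recipConv S f w * (if w ≤ y then 1 else 0) =
        1 / f ((x : P) ⊓ y) := by
      rw [← hs, Finset.sum_filter]
      refine Finset.sum_congr rfl fun w _ => ?_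
      have : w ≤ (⟨(x : P) ⊓ y, hS x.2 y.2⟩ : S) ↔ w ≤ x ∧ w ≤ y :=
        (le_inf_iff : (w : P) ≤ (x : P) ⊓ y ↔ _)
      rw [if_congr this rfl rfl]
      by_cases h1 : w ≤ x <;> by_cases h2 : w ≤ y <;> simp [h1, h2]
    rw [this]
    have h0 := hf.2 ((x : P) ⊓ y)
    have h1 := hf.1 x y
    field_simp
    linear_combination -h1
  rw [hfac]
  exact ((hd _ fun z => hf.2 z).mul ((hE.mul (hd _ h)).mul hET)).mul (hd _ fun z => hf.2 z)

end Convolution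

/-! ### Method numbers as cover counts, and elements covering at most two others. -/

section Methods

variable {P : Type*} [Lattice P]

/-- Whatever lies strictly between x j and x i is enumerated before x i, so covering in the initial
segment is covering in S. -/
theorem methodNumber_eq_ncard {S : Finset P} {n : ℕ} {x : Fin n ≃ S}
    (hx : IsLinearEnumeration x) (i : Fin n) :
    methodNumber x i = Set.ncard {w : S | w ⋖ x i} := by
  unfold methodNumber
  rw [← Set.ncard_image_of_injective _ x.injective]
  congr 1
  ext w
  obtain ⟨j, rfl⟩ := x.surjective w
  simp only [Set.mem_image, Set.mem_ofPred_eq, EmbeddingLike.apply_eq_iff_eq, exists_eq_right]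
  constructor
  · rintro ⟨-, h, h'⟩
    refine ⟨h, fun c hc hc' => ?_⟩
    obtain ⟨k, rfl⟩ := x.surjective c
    exact h' k (hx _ _ hc').le ⟨hc, hc'⟩
  · intro h
    exact ⟨hx _ _ h.lt, h.lt, fun k _ hk => h.2 hk.1 hk.2⟩

theorem exists_isLinearEnumeration (S : Finset P) :
    ∃ x : Fin S.card ≃ S, IsLinearEnumeration x := by
  classical
  let : Fintype (LinearExtension S) := inferInstanceAs (Fintype S)
  have hc : Fintype.card (LinearExtension S) = S.card := Fintype.card_coe S
  let e := (monoEquivOfFin (LinearExtension S) hc)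
  refine ⟨e.toEquiv.trans (Equiv.refl S), fun i j hij => ?_⟩
  have h1 : e i ≤ e j := (toLinearExtension (α := S)).monotone'
    (show (Equiv.refl S (e i) : S) ≤ Equiv.refl S (e j) from hij.le)
  have h2 : i ≤ j := e.le_iff_le.1 h1
  refine lt_of_le_of_ne h2 ?_
  rintro rfl
  exact lt_irrefl _ hij

theorem constructibleWith_iff (k : ℕ) (S : Finset P) :
    ConstructibleWith k S ↔ ∀ z : S, Set.ncard {w : S | w ⋖ z} ≤ k := by
  constructor
  · rintro ⟨n, x, hx, h⟩ z
    obtain ⟨i, rfl⟩ := x.surjective z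
    rw [← methodNumber_eq_ncard hx]
    exact h i
  · intro h
    obtain ⟨x, hx⟩ := exists_isLinearEnumeration S
    exact ⟨_, x, hx, fun i => (methodNumber_eq_ncard hx i).trans_le (h _)⟩

theorem recipConv_ne_zero_of_mem_classFk {k : ℕ} {f : P → ℂ} (hf : f ∈ classFk P k)
    {S : Finset P} (hS : InfClosed (S : Set P)) (h : ∀ z : S, Set.ncard {w : S | w ⋖ z} ≤ k)
    (z : S) : recipConv S f z ≠ 0 := by
  obtain ⟨x, hx⟩ := exists_isLinearEnumeration S
  have := hf.2 S hS _ x hx (fun i => (methodNumber_eq_ncard hx i).trans_le (h _)) (x.symm z)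
  simpa using this

theorem ncard_setOf_le_length {α β : Type*} {p : α → Prop} {g : α → β}
    (hg : Function.Injective g) (l : List β) (h : ∀ a, p a → g a ∈ l) :
    Set.ncard {a | p a} ≤ l.length := by
  classical
  rw [← Set.ncard_image_of_injective _ hg]
  refine (Set.ncard_le_ncard (t := (l.toFinset : Set β)) ?_ l.toFinset.finite_toSet).trans ?_
  · rintro _ ⟨w, hw, rfl⟩
    simpa using h w hw
  · rw [Set.ncard_coe_finset]
    exact l.toFinset_card_le

/-- Locality with the chain {a, z}. The case a = z is allowed and takes care of an element that
covers nothing. -/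
theorem recipConv_ne_zero_of_one {f : P → ℂ} (hf : f ∈ classFk P 1) {S : Finset P} (z a : S)
    (ha : a ≤ z) (hcov : ∀ w : S, w ⋖ z → w = a) : recipConv S f z ≠ 0 := by
  classical
  have ha' : (a : P) ≤ z := ha
  let T : Finset P := {(z : P), (a : P)}
  have hT : InfClosed (T : Set P) := by
    intro u hu v hv
    simp only [T, Finset.coe_insert, Finset.coe_singleton, Set.mem_insert_iff,
      Set.mem_singleton_iff] at hu hv ⊢
    rcases hu with rfl | rfl <;> rcases hv with rfl | rfl <;> simp [ha']
  have hTS : T ⊆ S := by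
    intro u hu
    simp only [T, Finset.mem_insert, Finset.mem_singleton] at hu
    rcases hu with rfl | rfl <;> simp
  have hz : (z : P) ∈ T := by simp [T]
  have := recipConv_eq_of_subset hT hTS f hz fun w hw => by
    rw [hcov w hw]; simp [T]
  rw [show z = ⟨z, hTS hz⟩ from rfl, ← this]
  refine recipConv_ne_zero_of_mem_classFk hf hT (fun t => ?_) _
  have ht : (t : P) = z ∨ (t : P) = a := by
    have := t.2
    simpa only [T, Finset.mem_insert, Finset.mem_singleton] using this
  rcases ht with ht | ht
  · refine ncard_setOf_le_length Subtype.val_injective [(a : P)] fun w hw => ?_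
    have hw' : (w : P) < t := hw.lt
    have := w.2
    simp only [T, Finset.mem_insert, Finset.mem_singleton] at this
    rcases this with h | h
    · rw [h, ht] at hw'
      exact absurd hw' (lt_irrefl _)
    · simp [h]
  · refine ncard_setOf_le_length Subtype.val_injective [(z : P)] fun w hw => ?_
    have hw' : (w : P) < t := hw.lt
    have := w.2
    simp only [T, Finset.mem_insert, Finset.mem_singleton] at this
    rcases this with h | h
    · simp [h]
    · rw [h, ht] at hw'
      exact absurd hw' (lt_irrefl _)

/-- Locality with {z, a, b, a ∧ b}. Coincidences among these elements are allowed, so that fewer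
than two covered elements fit in as well. -/
theorem recipConv_ne_zero_of_two {f : P → ℂ} (hf : f ∈ classFk P 2) {S : Finset P}
    (hS : InfClosed (S : Set P)) (z a b : S)
    (ha : a ≤ z) (hb : b ≤ z) (hcov : ∀ w : S, w ⋖ z → w = a ∨ w = b) :
    recipConv S f z ≠ 0 := by
  classical
  have ha' : (a : P) ≤ z := ha
  have hb' : (b : P) ≤ z := hb
  let T : Finset P := {(z : P), (a : P), (b : P), (a : P) ⊓ b}
  have hc' : (a : P) ⊓ b ≤ z := inf_le_left.trans ha'
  have hT : InfClosed (T : Set P) := by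
    intro u hu v hv
    simp only [T, Finset.coe_insert, Finset.coe_singleton, Set.mem_insert_iff,
      Set.mem_singleton_iff] at hu hv ⊢
    rcases hu with rfl | rfl | rfl | rfl <;> rcases hv with rfl | rfl | rfl | rfl <;>
      simp [ha', hb', hc', inf_comm]
  have hTS : T ⊆ S := by
    intro u hu
    simp only [T, Finset.mem_insert, Finset.mem_singleton] at hu
    rcases hu with rfl | rfl | rfl | rfl
    · exact z.2
    · exact a.2
    · exact b.2
    · exact hS a.2 b.2
  have hz : (z : P) ∈ T := by simp [T]
  have := recipConv_eq_of_subset hT hTS f hz fun w hw => by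
    rcases hcov w hw with h | h <;> rw [h] <;> simp [T]
  rw [show z = ⟨z, hTS hz⟩ from rfl, ← this]
  refine recipConv_ne_zero_of_mem_classFk hf hT (fun t => ?_) _
  have hmem : ∀ w : T, (w : P) = z ∨ (w : P) = a ∨ (w : P) = b ∨ (w : P) = (a : P) ⊓ b := by
    intro w
    have := w.2
    simpa only [T, Finset.mem_insert, Finset.mem_singleton] using this
  rcases hmem t with ht | ht | ht | ht
  · refine ncard_setOf_le_length Subtype.val_injective [(a : P), (b : P)] fun w hw => ?_
    have hw' : (w : P) < t := hw.lt
    rcases hmem w with h | h | h | h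
    · rw [h, ht] at hw'
      exact absurd hw' (lt_irrefl _)
    · simp [h]
    · simp [h]
    -- If a = z the meet is b; otherwise a ∧ b ≤ a < z, so z can cover the meet only if it equals a.
    · rcases ha'.eq_or_lt with haz | haz
      · rw [h, haz, inf_eq_right.2 hb']
        simp
      · have h1 : w ≤ (⟨a, by simp [T]⟩ : T) := by
          change (w : P) ≤ a
          rw [h]
          exact inf_le_left
        have h2 : (⟨a, by simp [T]⟩ : T) < t := by
          change (a : P) < t
          rwa [ht]
        rcases h1.eq_or_lt with h3 | h3
        · rw [h3]
          simp
        · exact absurd h2 (hw.2 h3)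
  · refine ncard_setOf_le_length Subtype.val_injective [(b : P), (a : P) ⊓ b] fun w hw => ?_
    have hw' : (w : P) < t := hw.lt
    rcases hmem w with h | h | h | h
    · rw [h, ht] at hw'
      exact absurd ha' hw'.not_ge
    · rw [h, ht] at hw'
      exact absurd hw' (lt_irrefl _)
    · simp [h]
    · simp [h]
  · refine ncard_setOf_le_length Subtype.val_injective [(a : P), (a : P) ⊓ b] fun w hw => ?_
    have hw' : (w : P) < t := hw.lt
    rcases hmem w with h | h | h | h
    · rw [h, ht] at hw'
      exact absurd hb' hw'.not_ge
    · simp [h]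
    · rw [h, ht] at hw'
      exact absurd hw' (lt_irrefl _)
    · simp [h]
  · refine (ncard_setOf_le_length Subtype.val_injective ([] : List P) fun w hw => ?_).trans
      (by simp)
    have hw' : (w : P) < t := hw.lt
    rw [ht] at hw'
    rcases hmem w with h | h | h | h <;> rw [h] at hw'
    · exact absurd hc' hw'.not_ge
    · exact absurd inf_le_left hw'.not_ge
    · exact absurd inf_le_right hw'.not_ge
    · exact absurd hw' (lt_irrefl _)

end Methods

end JoinMatrix

namespace JoinMatrix

/-! ### Transfer of nonvanishing from diagrams to sets. -/

section Subdiagrams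

variable {P : Type*} [Lattice P] {n : ℕ}

/-- Reachability in at most `k` steps downwards in the diagram `D`. -/
def below (D : HasseDiagram n) : ℕ → Fin n → Fin n → Bool
  | 0, _, _ => false
  | k + 1, i, j => decide (i = j) || (D j).any fun m => below D k i m

/-- In a finite poset the order is generated by covers. Labels drop along each cover, so fuel larger
than the label j is enough. -/
theorem below_iff {D : HasseDiagram n} {S : Finset P} {e : Fin n ≃ S} (he : Realizes D e)
    (hD : ∀ j, ∀ i ∈ D j, i < j) (k : ℕ) (i j : Fin n) (hj : (j : ℕ) < k) :
    below D k i j = true ↔ e i ≤ e j := by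
  induction k generalizing j with
  | zero => omega
  | succ k ih =>
    rw [below, Bool.or_eq_true, decide_eq_true_iff, List.any_eq_true]
    constructor
    · rintro (rfl | ⟨m, hm, h⟩)
      · exact le_rfl
      · have hlt : (m : ℕ) < j := hD j m hm
        exact ((ih m (by omega)).1 h).trans ((he m j).1 hm).le
    · intro h
      rcases h.eq_or_lt with h | h
      · exact Or.inl (e.injective h)
      · obtain ⟨c, hc, hcj⟩ := exists_le_covBy_of_lt h
        obtain ⟨m, rfl⟩ := e.surjective c
        have hm := (he m j).2 hcj
        have hlt : (m : ℕ) < j := hD j m hm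
        exact Or.inr ⟨m, hm, (ih m (by omega)).2 hc⟩

/-- Strict reachability in the diagram `D`. -/
def strictlyBelow (D : HasseDiagram n) (i j : Fin n) : Bool :=
  below D n i j && !decide (i = j)

/-- The vertices in the image of `φ` form a meet closed set that contains `v` and the vertices
covered by `v`, and that has the diagram `D'` with greatest element `v`. -/
def IsSubdiagram {m : ℕ} (D : HasseDiagram n) (v : Fin n) (D' : HasseDiagram (m + 1))
    (φ : Fin (m + 1) → Fin n) : Prop :=
  φ (Fin.last m) = v ∧ (∀ i ∈ D v, ∃ j, φ j = i) ∧ (∀ i j, φ i = φ j → i = j) ∧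
    (∀ i j, ∃ k, below D n (φ k) (φ i) = true ∧ below D n (φ k) (φ j) = true ∧
      ∀ l, below D n l (φ i) = true → below D n l (φ j) = true → below D n l (φ k) = true) ∧
    ∀ i j, i ∈ D' j ↔ strictlyBelow D (φ i) (φ j) = true ∧
      ∀ k, ¬ (strictlyBelow D (φ i) (φ k) = true ∧ strictlyBelow D (φ k) (φ j) = true)

instance {m : ℕ} (D : HasseDiagram n) (v : Fin n) (D' : HasseDiagram (m + 1))
    (φ : Fin (m + 1) → Fin n) : Decidable (IsSubdiagram D v D' φ) := by
  unfold IsSubdiagram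
  infer_instance

theorem recipConv_ne_zero_of_isSubdiagram {m : ℕ} {D : HasseDiagram n} {S : Finset P}
    (hS : InfClosed (S : Set P)) {e : Fin n ≃ S} (he : Realizes D e)
    (hD : ∀ j, ∀ i ∈ D j, i < j) {v : Fin n} {D' : HasseDiagram (m + 1)}
    {φ : Fin (m + 1) → Fin n} (hφ : IsSubdiagram D v D' φ) {f : P → ℂ} (hf : f ∈ classG P D') :
    recipConv S f (e v) ≠ 0 := by
  classical
  obtain ⟨hlast, hcov, hinj, hmeet, hD'⟩ := hφ
  have hb : ∀ i j, below D n i j = true ↔ e i ≤ e j := fun i j => below_iff he hD n i j j.2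
  have hsb : ∀ i j, strictlyBelow D i j = true ↔ (e i : P) < e j := by
    intro i j
    rw [strictlyBelow, Bool.and_eq_true, hb, Bool.not_eq_true', decide_eq_false_iff_not]
    exact (and_congr_right fun _ => not_congr e.injective.eq_iff.symm).trans
      (lt_iff_le_and_ne (a := e i) (b := e j)).symm
  let T : Finset P := Finset.univ.image fun i => (e (φ i) : P)
  have hmemT : ∀ i, (e (φ i) : P) ∈ T := fun i =>
    Finset.mem_image_of_mem _ (Finset.mem_univ i)
  have hTS : T ⊆ S := by
    intro u hu
    obtain ⟨i, -, rfl⟩ := Finset.mem_image.1 hu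
    exact (e (φ i)).2
  have hT : InfClosed (T : Set P) := by
    intro u hu u' hu'
    obtain ⟨i, -, rfl⟩ := Finset.mem_image.1 hu
    obtain ⟨j, -, rfl⟩ := Finset.mem_image.1 hu'
    obtain ⟨k, hki, hkj, hk⟩ := hmeet i j
    obtain ⟨l, hl⟩ := e.surjective ⟨_, hS (e (φ i)).2 (e (φ j)).2⟩
    have hl' : (e l : P) = (e (φ i) : P) ⊓ e (φ j) := by rw [hl]
    have h1 : (e l : P) ≤ e (φ k) := (hb _ _).1 <| hk l
      ((hb _ _).2 (hl'.trans_le inf_le_left)) ((hb _ _).2 (hl'.trans_le inf_le_right))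
    have h2 : (e (φ k) : P) ≤ (e (φ i) : P) ⊓ e (φ j) :=
      le_inf ((hb _ _).1 hki) ((hb _ _).1 hkj)
    -- The meet in P lies in S, hence is some vertex l; so the greatest lower bound computed in the
    -- diagram is the true meet.
    rw [← le_antisymm h2 (hl'.symm.trans_le h1)]
    exact hmemT k
  let y : Fin (m + 1) → T := fun i => ⟨e (φ i), hmemT i⟩
  have hy : Function.Bijective y := by
    constructor
    · intro i j hij
      have h : (e (φ i) : P) = e (φ j) := congrArg (fun t : T => (t : P)) hij
      exact hinj i j (e.injective (Subtype.ext h))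
    · rintro ⟨u, hu⟩
      obtain ⟨i, -, rfl⟩ := Finset.mem_image.1 hu
      exact ⟨i, rfl⟩
  have hreal : Realizes D' (Equiv.ofBijective y hy) := by
    intro i j
    rw [hD' i j, hsb]
    simp only [hsb]
    constructor
    · rintro ⟨h, h'⟩
      refine ⟨h, fun c hc hc' => ?_⟩
      obtain ⟨k, rfl⟩ := hy.2 c
      exact h' k ⟨hc, hc'⟩
    · rintro h
      exact ⟨h.lt, fun k hk => h.2 (c := y k) hk.1 hk.2⟩
  have key := hf.2 T hT _ hreal
  have hz : (e v : P) ∈ T := by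
    rw [← hlast]
    exact hmemT _
  have hloc := recipConv_eq_of_subset hT hTS f hz fun w hw => by
    obtain ⟨i, rfl⟩ := e.surjective w
    obtain ⟨j, rfl⟩ := hcov i ((he i v).2 hw)
    exact hmemT j
  have hEq : Equiv.ofBijective y hy (Fin.last m) = ⟨e v, hz⟩ :=
    Subtype.ext (by simp [y, hlast])
  rw [hEq, hloc] at key
  exact key

theorem recipConv_ne_zero_of_length_le {k : ℕ} (hk : k = 1 ∨ k = 2) {D : HasseDiagram n}
    {S : Finset P} (hS : InfClosed (S : Set P)) {e : Fin n ≃ S} (he : Realizes D e) {v : Fin n}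
    (hv : (D v).length ≤ k) {f : P → ℂ} (hf : f ∈ classFk P k) : recipConv S f (e v) ≠ 0 := by
  have hmem : ∀ w : S, w ⋖ e v → ∃ i ∈ D v, e i = w := by
    intro w hw
    obtain ⟨i, rfl⟩ := e.surjective w
    exact ⟨i, (he i v).2 hw, rfl⟩
  have hle : ∀ i ∈ D v, e i ≤ e v := fun i hi => ((he i v).1 hi).le
  match hl : D v, k, hk with
  | [], 1, _ =>
    refine recipConv_ne_zero_of_one hf _ (e v) le_rfl fun w hw => ?_
    obtain ⟨i, hi, -⟩ := hmem w hw
    simp [hl] at hi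
  | [a], 1, _ =>
    refine recipConv_ne_zero_of_one hf _ (e a) (hle a (by simp [hl])) fun w hw => ?_
    obtain ⟨i, hi, rfl⟩ := hmem w hw
    rw [hl, List.mem_singleton] at hi
    rw [hi]
  | a :: b :: _, 1, _ => simp [hl] at hv
  | [], 2, _ =>
    refine recipConv_ne_zero_of_two hf hS _ (e v) (e v) le_rfl le_rfl fun w hw => ?_
    obtain ⟨i, hi, -⟩ := hmem w hw
    simp [hl] at hi
  | [a], 2, _ =>
    have ha := hle a (by simp [hl])
    refine recipConv_ne_zero_of_two hf hS _ (e a) (e a) ha ha fun w hw => ?_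
    obtain ⟨i, hi, rfl⟩ := hmem w hw
    rw [hl, List.mem_singleton] at hi
    exact Or.inl (congrArg e hi)
  | [a, b], 2, _ =>
    refine recipConv_ne_zero_of_two hf hS _ (e a) (e b) (hle a (by simp [hl]))
      (hle b (by simp [hl])) fun w hw => ?_
    obtain ⟨i, hi, rfl⟩ := hmem w hw
    rw [hl, List.mem_cons, List.mem_singleton] at hi
    exact hi.imp (congrArg e) (congrArg e)
  | a :: b :: c :: _, 2, _ => simp [hl] at hv

/-- Reduces invertibility for a whole list of classes to a decidable statement about the diagrams
alone. -/
theorem isUnit_joinMatrix_of_inClasses [DecidableEq P] {m k : ℕ} (hk : k = 1 ∨ k = 2)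
    {L : List (HasseDiagram n)} {D' : HasseDiagram (m + 1)}
    (hL : ∀ D ∈ L, (∀ j, ∀ i ∈ D j, i < j) ∧
      ∀ v, (D v).length ≤ k ∨ ∃ φ, IsSubdiagram D v D' φ)
    {S : Finset P} (hS : InfClosed (S : Set P)) (h : InClasses L S) {f : P → ℂ}
    (hf : f ∈ classFk P k ∩ classG P D') : IsUnit (joinMatrix S f) := by
  obtain ⟨D, hD, e, he⟩ := h
  obtain ⟨h1, h2⟩ := hL D hD
  refine isUnit_joinMatrix hS hf.1.1 fun z => ?_
  obtain ⟨v, rfl⟩ := e.surjective z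
  rcases h2 v with hv | ⟨φ, hφ⟩
  · exact recipConv_ne_zero_of_length_le hk hS he hv hf.1
  · exact recipConv_ne_zero_of_isSubdiagram hS he h1 hφ hf.2

end Subdiagrams

/-! ### Finite checks locating the special structures in the diagrams. -/

section Diagrams

/-- The map that lists the entries of `l`. -/
def listMap (m : ℕ) (l : List (Fin 7)) : Fin m → Fin 7 := fun i => l.getD i 0

/-- The embedding lists the common meet b of the covered vertices, those vertices, and v. A vertex
failing the first alternative covers exactly three here, so the list has length five and the default
of `listMap` is not used. -/
theorem subdiagram_diagrams7A : ∀ D ∈ diagrams7A, (∀ j, ∀ i ∈ D j, i < j) ∧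
    ∀ v, (D v).length ≤ 1 ∨ ∃ b, IsSubdiagram D v diagramS35 (listMap 5 (b :: D v ++ [v])) := by
  decide +kernel

theorem subdiagram_diagrams7B : ∀ D ∈ diagrams7B, (∀ j, ∀ i ∈ D j, i < j) ∧
    ∀ v, (D v).length ≤ 1 ∨
      ∃ (b c : Fin 7) (r : Fin 3),
        -- The rotation selects the covered vertex that plays the atom 2; the other two, above c,
        -- are interchangeable.
        IsSubdiagram D v diagramS36 (listMap 6 (b :: c :: (D v).rotate r ++ [v])) := by
  decide +kernel

theorem subdiagram_diagrams7C : ∀ D ∈ diagrams7C, (∀ j, ∀ i ∈ D j, i < j) ∧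
    ∀ v, (D v).length ≤ 2 ∨ ∃ b, IsSubdiagram D v diagramS35 (listMap 5 (b :: D v ++ [v])) := by
  decide +kernel

theorem subdiagram_diagrams7D : ∀ D ∈ diagrams7D, (∀ j, ∀ i ∈ D j, i < j) ∧
    ∀ v, (D v).length ≤ 1 ∨ ∃ b, IsSubdiagram D v diagramS46 (listMap 6 (b :: D v ++ [v])) := by
  decide +kernel

theorem subdiagram_diagrams7E : ∀ D ∈ diagrams7E, (∀ j, ∀ i ∈ D j, i < j) ∧
    ∀ v, (D v).length ≤ 2 ∨
      ∃ b c, IsSubdiagram D v diagramS36 (listMap 6 (b :: c :: D v ++ [v])) := by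
  decide +kernel

theorem subdiagram_diagrams7F : ∀ D ∈ diagrams7F, (∀ j, ∀ i ∈ D j, i < j) ∧
    ∀ v, (D v).length ≤ 2 ∨ IsSubdiagram D v diagramS37 id := by
  decide +kernel

theorem subdiagram_diagrams7G : ∀ D ∈ diagrams7G, (∀ j, ∀ i ∈ D j, i < j) ∧
    ∀ v, (D v).length ≤ 1 ∨ IsSubdiagram D v diagramS47one id := by
  decide +kernel

theorem subdiagram_diagrams7H : ∀ D ∈ diagrams7H, (∀ j, ∀ i ∈ D j, i < j) ∧
    ∀ v, (D v).length ≤ 1 ∨ IsSubdiagram D v diagramS47two id := by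
  decide +kernel

theorem subdiagram_diagrams7I : ∀ D ∈ diagrams7I, (∀ j, ∀ i ∈ D j, i < j) ∧
    ∀ v, (D v).length ≤ 1 ∨ IsSubdiagram D v diagramS57 id := by
  decide +kernel

end Diagrams

end JoinMatrix

namespace JoinMatrix

/-! ### Enumeration of meet semilattices by bit masks. -/

section MaskLists

/-- The value `f x`; the kernel evaluates `x` first. -/
def force (x : ℕ) (f : ℕ → Bool) : Bool :=
  match x with
  | 0 => f 0
  | n + 1 => f (Nat.succ n)

/-- `p` holds for all extensions of `l` by `k` further masks that may be the masks of the elements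
of a meet semilattice. -/
def forallMasks (p : List ℕ → Bool) : ℕ → List ℕ → Bool
  | 0, l => p l
  | k + 1, l => (List.range (Nat.pow 2 l.length)).all fun I =>
      -- In a linear extension the highest bit of a down-set mask is the element's own position; I
      -- codes the elements strictly below.
      force (Nat.add (Nat.pow 2 l.length) I) fun M =>
      !(l.all fun c => force (Nat.land M c) fun x => l.any (Nat.beq x)) ||
        forallMasks p k (l ++ [M])

/-- The inclusion of bit masks. -/
def maskLE (a b : ℕ) : Bool := Nat.beq (Nat.land a b) a

/-- The maximal masks in `l`. -/
def maximalMasks (l : List ℕ) : List ℕ :=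
  l.filter fun a => l.all fun b => !maskLE a b || Nat.beq a b

/-- The number of binary digits `1` of a mask below `2 ^ 14`. -/
def maskSize (a : ℕ) : ℕ :=
  -- The product places four copies of a at offsets 0, 15, 30, 45. Each bit falls on a multiple of 4
  -- in exactly one copy, and since 16 ≡ 1 mod 15 the remainder counts the bits kept.
  Nat.mod (Nat.land (Nat.mul a 0x200040008001) 0x111111111111111) 15

/-- Backtracking search for an arrangement of the masks in `l` that is order isomorphic to the
given list of masks. -/
def searchIso (l : List ℕ) : List ℕ → List (ℕ × ℕ) → Bool
  | [], _ => true
  | d :: ds, q => l.any fun v => Nat.beq (maskSize v) (maskSize d) &&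
      -- The pattern is a linear extension, so d is never below an earlier x.1. Forbidding v below
      -- x.2 also keeps the chosen masks distinct.
      (q.all (fun x => bif maskLE x.1 d then maskLE x.2 v && !maskLE v x.2 else
        !maskLE x.2 v && !maskLE v x.2) &&
        searchIso l ds (q ++ [(d, v)]))

/-- The sum of the squares of the sizes of the masks in `l`. -/
def sizeInvariant (l : List ℕ) : ℕ :=
  l.foldr (fun a s => Nat.add (Nat.pow (maskSize a) 2) s) 0

/-- The down-set masks of the diagrams in `diagrams7`, with the values of `sizeInvariant`. -/
def maskTable : List (ℕ × List ℕ) :=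
  [ (78, [1, 3, 5, 9, 31, 63, 65]), (83, [1, 3, 5, 9, 31, 63, 67]), (110, [1, 3, 5, 9, 31, 63, 95]),
    (123, [1, 3, 5, 9, 31, 63, 127]), (51, [1, 3, 5, 9, 19, 47, 65]),
    (56, [1, 3, 5, 9, 25, 47, 67]), (56, [1, 3, 5, 9, 19, 47, 67]), (63, [1, 3, 5, 9, 19, 47, 83]),
    (46, [1, 3, 5, 9, 17, 47, 65]), (51, [1, 3, 5, 9, 17, 55, 73]), (72, [1, 3, 7, 11, 19, 63, 65]),
    (77, [1, 3, 7, 11, 19, 63, 67]), (84, [1, 3, 7, 11, 19, 63, 71]),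
    (117, [1, 3, 7, 11, 19, 63, 127]), (62, [1, 3, 5, 9, 21, 63, 65]),
    (67, [1, 3, 5, 9, 21, 63, 67]), (67, [1, 3, 5, 9, 21, 63, 69]), (74, [1, 3, 5, 9, 21, 63, 85]),
    (107, [1, 3, 5, 9, 21, 63, 127]), (87, [1, 3, 5, 9, 21, 53, 127]),
    (97, [1, 3, 7, 11, 19, 39, 127]), (111, [1, 3, 7, 15, 23, 39, 127]),
    (80, [1, 3, 5, 9, 19, 41, 127]), (67, [1, 3, 5, 11, 19, 63, 65]),
    (72, [1, 3, 5, 11, 19, 63, 67]), (72, [1, 3, 5, 13, 21, 63, 67]),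
    (79, [1, 3, 5, 13, 21, 63, 85]), (112, [1, 3, 5, 13, 21, 63, 127]),
    (99, [1, 3, 5, 11, 27, 43, 127]), (92, [1, 3, 5, 11, 19, 43, 127]),
    (104, [1, 3, 7, 11, 23, 39, 127]), (85, [1, 3, 5, 11, 19, 37, 127]),
    (96, [1, 3, 5, 9, 19, 47, 127]), (91, [1, 3, 5, 9, 17, 47, 127]),
    (58, [1, 3, 5, 9, 17, 47, 89]), (82, [1, 3, 5, 9, 17, 39, 127]),
    (92, [1, 3, 5, 13, 21, 39, 127]), (57, [1, 3, 5, 9, 17, 63, 65]),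
    (62, [1, 3, 5, 9, 17, 63, 81]), (102, [1, 3, 5, 9, 17, 63, 127]),
    (90, [1, 3, 7, 11, 19, 35, 127]), (75, [1, 3, 5, 9, 17, 37, 127]),
    (87, [1, 3, 5, 9, 21, 45, 127]), (92, [1, 3, 5, 11, 21, 39, 127]),
    (85, [1, 3, 5, 11, 19, 35, 127]), (80, [1, 3, 5, 9, 19, 35, 127]),
    (70, [1, 3, 5, 9, 17, 33, 127]) ]

/-- The masks in `l` are order isomorphic to those of an entry of `maskTable`. -/
def classified (l : List ℕ) : Bool :=
  force (sizeInvariant l) fun k => maskTable.any fun D =>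
    Nat.beq D.1 k && searchIso l D.2 []

/-- All lists of seven masks that are meet closed, and in which the mask at position `m` contains
exactly the masks up to that position and covers at least three of them, are `classified`. -/
def classifiedBelow (m : ℕ) : Bool :=
  forallMasks (fun l => Nat.ble (maximalMasks l).length 2 ||
    forallMasks classified (6 - m) (l ++ [Nat.sub (Nat.pow 2 (Nat.succ m)) 1])) m []

/-- The exhaustive computation behind the completeness of the 47 classes. Listing the down-set of
the element with three covers first fixes its mask as 2 ^ (m + 1) - 1, which cuts the search. -/
theorem classifiedBelow_of_lt {m : ℕ} (hm : m < 7) : classifiedBelow m = true := by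
  have h : [0, 1, 2, 3, 4, 5, 6].all classifiedBelow = true := by decide +kernel
  exact List.all_eq_true.1 h m (by simp; omega)

/-- The masks `d` are listed in a linear extension of their order, which has the diagram `D`. -/
def IsDiagramOf (d : List ℕ) (D : HasseDiagram 7) : Prop :=
  d.length = 7 ∧
    (∀ i j : Fin 7, i < j → maskLE (d.getD j 0) (d.getD i 0) = false) ∧
    ∀ i j : Fin 7, i ∈ D j ↔ (i ≠ j ∧ maskLE (d.getD i 0) (d.getD j 0) = true) ∧
      ∀ k : Fin 7, k ≠ i → k ≠ j → ¬ (maskLE (d.getD i 0) (d.getD k 0) = true ∧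
        maskLE (d.getD k 0) (d.getD j 0) = true)

instance (d : List ℕ) (D : HasseDiagram 7) : Decidable (IsDiagramOf d D) := by
  unfold IsDiagramOf
  infer_instance

theorem exists_isDiagramOf : ∀ t ∈ maskTable, ∃ D ∈ diagrams7, IsDiagramOf t.2 D := by
  decide +kernel

theorem force_eq (x : ℕ) (f : ℕ → Bool) : force x f = f x := by
  cases x <;> rfl

theorem maskLE_iff (a b : ℕ) : maskLE a b = true ↔ a &&& b = a := by
  rw [maskLE, Nat.beq_eq]
  rfl

theorem forallMasks_sound {d : ℕ → ℕ} {N : ℕ} (h1 : ∀ n < N, 2 ^ n ≤ d n ∧ d n < 2 ^ (n + 1))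
    (h2 : ∀ n < N, ∀ j < n, ∃ k < n, d n &&& d j = d k) {p : List ℕ → Bool} (k n : ℕ)
    (hn : n + k ≤ N) (h : forallMasks p k ((List.range n).map d) = true) :
    p ((List.range (n + k)).map d) = true := by
  induction k generalizing n with
  | zero => exact h
  | succ k ih =>
    have hN : n < N := by omega
    obtain ⟨hl, hu⟩ := h1 n hN
    rw [pow_succ] at hu
    rw [forallMasks, List.all_eq_true] at h
    simp only [List.length_map, List.length_range, force_eq] at h
    have h' := h (d n - 2 ^ n) (List.mem_range.2 (show d n - 2 ^ n < 2 ^ n by omega))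
    have hd : Nat.add (Nat.pow 2 n) (d n - 2 ^ n) = d n :=
      show 2 ^ n + (d n - 2 ^ n) = d n by omega
    rw [hd, Bool.or_eq_true] at h'
    have hadd : n + (k + 1) = n + 1 + k := by omega
    rw [hadd]
    refine ih (n + 1) (by omega) ?_
    rw [List.range_succ, List.map_append, List.map_singleton]
    refine h'.resolve_left fun hc => ?_
    rw [Bool.not_eq_true', ← Bool.not_eq_true, List.all_eq_true] at hc
    refine hc fun c hc => ?_
    obtain ⟨j, hj, rfl⟩ := List.mem_map.1 hc
    obtain ⟨i, hi, hij⟩ := h2 n hN j (List.mem_range.1 hj)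
    exact List.any_eq_true.2 ⟨d i, List.mem_map_of_mem (List.mem_range.2 hi), Nat.beq_eq.mpr hij⟩

/-- Two pairs of masks are in the same order, and the second mask is not below the first. -/
def SameOrder (x y : ℕ × ℕ) : Prop :=
  (maskLE x.2 y.2 = true ↔ maskLE x.1 y.1 = true) ∧ ¬ maskLE y.2 x.2 = true

/-- The size comparison in the search only prunes and is discarded here, so no property of
`maskSize` has to be proved. -/
theorem searchIso_sound {l : List ℕ} (ds : List ℕ) (q : List (ℕ × ℕ))
    (h : searchIso l ds q = true) (hq : q.Pairwise SameOrder) (hql : ∀ x ∈ q, x.2 ∈ l) :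
    ∃ q' : List (ℕ × ℕ), q'.map Prod.fst = q.map Prod.fst ++ ds ∧ q'.Pairwise SameOrder ∧
      ∀ x ∈ q', x.2 ∈ l := by
  induction ds generalizing q with
  | nil => exact ⟨q, by simp, hq, hql⟩
  | cons d ds ih =>
    rw [searchIso, List.any_eq_true] at h
    obtain ⟨v, hv, h⟩ := h
    rw [Bool.and_eq_true, Bool.and_eq_true, List.all_eq_true] at h
    obtain ⟨-, h, hs⟩ := h
    obtain ⟨q', h1, h2, h3⟩ := ih (q ++ [(d, v)]) hs
      (by
        rw [List.pairwise_append]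
        refine ⟨hq, List.pairwise_singleton _ _, fun x hx y hy => ?_⟩
        rw [List.mem_singleton] at hy
        subst hy
        have := h x hx
        unfold SameOrder
        cases h4 : maskLE x.1 d <;> simp_all)
      (by
        intro x hx
        rcases List.mem_append.1 hx with hx | hx
        · exact hql x hx
        · rw [List.mem_singleton] at hx
          rwa [hx])
    exact ⟨q', by simpa using h1, h2, h3⟩

theorem exists_of_classified {l : List ℕ} (h : classified l = true) :
    ∃ D ∈ diagrams7, ∃ q : Fin 7 → ℕ, (∀ i, q i ∈ l) ∧
      (∀ i j, i ≠ j → ¬ (maskLE (q i) (q j) = true ∧ maskLE (q j) (q i) = true)) ∧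
      ∀ i j, i ∈ D j ↔ (i ≠ j ∧ maskLE (q i) (q j) = true) ∧
        ∀ k, k ≠ i → k ≠ j → ¬ (maskLE (q i) (q k) = true ∧ maskLE (q k) (q j) = true) := by
  rw [classified, force_eq, List.any_eq_true] at h
  obtain ⟨t, ht, h⟩ := h
  rw [Bool.and_eq_true] at h
  obtain ⟨D, hD, hlen, hord, hcov⟩ := exists_isDiagramOf t ht
  obtain ⟨q, hq1, hq2, hq3⟩ := searchIso_sound t.2 [] h.2 List.Pairwise.nil (by simp)
  rw [List.map_nil, List.nil_append] at hq1
  have hql : q.length = 7 := by rw [← hlen, ← hq1, List.length_map]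
  let y : Fin 7 → ℕ × ℕ := fun i => q[(i : ℕ)]'(by omega)
  have hy : ∀ i : Fin 7, t.2.getD i 0 = (y i).1 := by
    intro i
    have hi : (i : ℕ) < (q.map Prod.fst).length := by simp [hql]
    rw [← hq1, List.getD_eq_getElem _ _ hi, List.getElem_map]
  have hlt : ∀ i j : Fin 7, i < j → SameOrder (y i) (y j) := fun i j hij =>
    List.pairwise_iff_getElem.1 hq2 i j (by omega) (by omega) hij
  have hrefl : ∀ a, maskLE a a = true := fun a => (maskLE_iff a a).2 (Nat.and_self a)
  have hsame : ∀ i j : Fin 7, maskLE (t.2.getD i 0) (t.2.getD j 0) = true ↔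
      maskLE (y i).2 (y j).2 = true := by
    intro i j
    rcases lt_trichotomy i j with hij | rfl | hij
    · rw [hy, hy]
      exact (hlt i j hij).1.symm
    · simp only [hrefl]
    · rw [hord j i hij]
      simpa using (hlt j i hij).2
  refine ⟨D, hD, fun i => (y i).2, fun i => hq3 _ (List.getElem_mem _), ?_, ?_⟩
  · rintro i j hij ⟨h1, h2⟩
    rcases lt_or_gt_of_ne hij with hij | hij
    · exact (hlt i j hij).2 h2
    · exact (hlt j i hij).2 h1
  · intro i j
    rw [hcov i j]
    simp only [hsame]

end MaskLists

/-! ### Down-set masks of an actual meet closed set, and the classification. -/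

section Classification

variable {P : Type*} [Lattice P]

open Classical in
/-- The set of the positions, in the enumeration `x`, of the elements below `w`. -/
noncomputable def downMask {S : Finset P} {n : ℕ} (x : Fin n ≃ S) (w : S) : ℕ :=
  Nat.ofBits fun i : Fin n => decide (x i ≤ w)

variable {S : Finset P} {n : ℕ} {x : Fin n ≃ S}

theorem testBit_downMask (x : Fin n ≃ S) (w : S) (i : Fin n) :
    (downMask x w).testBit i = true ↔ x i ≤ w := by
  classical
  rw [downMask, Nat.testBit_ofBits_lt _ _ i.2]
  exact decide_eq_true_iff

theorem testBit_downMask_of_le (x : Fin n ≃ S) (w : S) {i : ℕ} (hi : n ≤ i) :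
    (downMask x w).testBit i = false :=
  Nat.testBit_ofBits_ge _ _ hi

theorem downMask_and (x : Fin n ≃ S) (u v : S) {w : S} (hw : (w : P) = (u : P) ⊓ v) :
    downMask x u &&& downMask x v = downMask x w := by
  refine Nat.eq_of_testBit_eq fun i => ?_
  rw [Nat.testBit_and]
  rcases lt_or_ge i n with hi | hi
  · rw [Bool.eq_iff_iff, Bool.and_eq_true, testBit_downMask x u ⟨i, hi⟩,
      testBit_downMask x v ⟨i, hi⟩, testBit_downMask x w ⟨i, hi⟩]
    change (x ⟨i, hi⟩ : P) ≤ u ∧ (x ⟨i, hi⟩ : P) ≤ v ↔ (x ⟨i, hi⟩ : P) ≤ w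
    rw [hw, le_inf_iff]
  · simp [testBit_downMask_of_le x _ hi]

theorem downMask_injective (x : Fin n ≃ S) : Function.Injective (downMask x) := by
  intro u v h
  obtain ⟨i, rfl⟩ := x.surjective u
  obtain ⟨j, rfl⟩ := x.surjective v
  exact le_antisymm
    ((testBit_downMask x _ i).1 (h ▸ (testBit_downMask x _ i).2 le_rfl))
    ((testBit_downMask x _ j).1 (h ▸ (testBit_downMask x _ j).2 le_rfl))

theorem maskLE_downMask (x : Fin n ≃ S) (u v : S) :
    maskLE (downMask x u) (downMask x v) = true ↔ u ≤ v := by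
  rw [maskLE_iff]
  constructor
  · intro h
    obtain ⟨i, rfl⟩ := x.surjective u
    have hi := (testBit_downMask x (x i) i).2 le_rfl
    rw [← h, Nat.testBit_and, Bool.and_eq_true] at hi
    exact (testBit_downMask x v i).1 hi.2
  · intro h
    exact downMask_and x u v (inf_eq_left.2 h).symm

theorem downMask_bounds (hx : IsLinearEnumeration x) (i : Fin n) :
    2 ^ (i : ℕ) ≤ downMask x (x i) ∧ downMask x (x i) < 2 ^ ((i : ℕ) + 1) := by
  constructor
  · exact Nat.ge_two_pow_of_testBit ((testBit_downMask x (x i) i).2 le_rfl)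
  · refine Nat.lt_pow_two_of_testBit _ fun j hj => ?_
    rcases lt_or_ge j n with hjn | hjn
    · rw [← Bool.not_eq_true, testBit_downMask x (x i) ⟨j, hjn⟩]
      intro h
      rcases h.eq_or_lt with h | h
      · have := x.injective h
        rw [← this] at hj
        simp at hj
      · have : j < (i : ℕ) := hx _ _ h
        omega
    · exact testBit_downMask_of_le x _ hjn

theorem exists_isLinearEnumeration_below {S : Finset P} {N : ℕ} (hN : S.card = N) (z : S) :
    ∃ x : Fin N ≃ S, IsLinearEnumeration x ∧ ∀ i, x i ≤ z ↔ i ≤ x.symm z := by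
  classical
  obtain ⟨y, hy⟩ := exists_isLinearEnumeration S
  -- Positions are below `S.card`, so the shift moves everything not below z behind z and keeps the
  -- keys distinct. It respects the order because the elements below z form a down-set.
  let key : S → ℕ := fun u => (y.symm u : ℕ) + if u ≤ z then 0 else S.card
  have hmono : ∀ u v, u < v → key u < key v := by
    intro u v huv
    have h1 : (y.symm u : ℕ) < y.symm v := hy _ _ (by simpa using huv)
    simp only [key]
    split_ifs with hu hv
    · omega
    · omega
    · exact absurd (huv.le.trans ‹_›) hu
    · omega
  have hinj : Function.Injective key := by
    intro u v h
    have h1 := (y.symm u).2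
    have h2 := (y.symm v).2
    simp only [key] at h
    have h3 : (y.symm u : ℕ) = y.symm v := by split_ifs at h <;> omega
    exact y.symm.injective (Fin.ext h3)
  have hle : ∀ u, u ≤ z ↔ key u ≤ key z := by
    intro u
    constructor
    · intro h
      rcases h.eq_or_lt with h | h
      · rw [h]
      · exact (hmono _ _ h).le
    · intro h
      by_contra hu
      have := (y.symm z).2
      simp only [key, le_refl, if_true, if_neg hu] at h
      omega
  let T := Finset.univ.image key
  have hT : T.card = N := by
    rw [Finset.card_image_of_injective _ hinj, Finset.card_univ, Fintype.card_coe, hN]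
  let g := T.orderIsoOfFin hT
  let k : S → T := fun u => ⟨key u, Finset.mem_image_of_mem _ (Finset.mem_univ u)⟩
  have hk : Function.Bijective k := by
    constructor
    · intro u v h
      exact hinj (Subtype.ext_iff.1 h)
    · rintro ⟨a, ha⟩
      obtain ⟨u, -, rfl⟩ := Finset.mem_image.1 ha
      exact ⟨u, rfl⟩
  let K := Equiv.ofBijective k hk
  let x : Fin N ≃ S := g.toEquiv.trans K.symm
  have hx : ∀ i, key (x i) = g i := fun i => Subtype.ext_iff.1 (K.apply_symm_apply (g i))
  have hxle : ∀ i j, key (x i) ≤ key (x j) ↔ i ≤ j := by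
    intro i j
    rw [hx, hx]
    exact g.le_iff_le
  refine ⟨x, fun i j h => ?_, fun i => ?_⟩
  · rw [← not_le, ← hxle, not_le]
    exact hmono _ _ h
  · rw [hle, ← hxle, Equiv.apply_symm_apply]

theorem inClasses_of_covers_three (hS : InfClosed (S : Set P)) (hcard : S.card = 7) {z : S}
    (hz : 2 < Set.ncard {w : S | w ⋖ z}) : InClasses diagrams7 S := by
  obtain ⟨x, hx, hxz⟩ := exists_isLinearEnumeration_below hcard z
  obtain ⟨m, rfl⟩ := x.surjective z
  simp only [Equiv.symm_apply_apply] at hxz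
  let d : ℕ → ℕ := fun k => if h : k < 7 then downMask x (x ⟨k, h⟩) else 0
  have hd : ∀ i : Fin 7, d i = downMask x (x i) := fun i => dif_pos i.2
  have h1 : ∀ n < 7, 2 ^ n ≤ d n ∧ d n < 2 ^ (n + 1) := by
    intro n hn
    rw [hd ⟨n, hn⟩]
    exact downMask_bounds hx ⟨n, hn⟩
  have h2 : ∀ n < 7, ∀ j < n, ∃ k < n, d n &&& d j = d k := by
    intro n hn j hj
    obtain ⟨k, hk⟩ := x.surjective ⟨_, hS (x ⟨n, hn⟩).2 (x ⟨j, hj.trans hn⟩).2⟩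
    have hk' : (x k : P) = (x ⟨n, hn⟩ : P) ⊓ x ⟨j, hj.trans hn⟩ := by rw [hk]
    have hkj : x k ≤ x ⟨j, hj.trans hn⟩ := hk'.trans_le inf_le_right
    refine ⟨k, ?_, ?_⟩
    · rcases hkj.eq_or_lt with h | h
      · rw [x.injective h]
        exact hj
      · exact lt_trans (hx _ _ h) hj
    · rw [hd k, hd ⟨n, hn⟩, hd ⟨j, hj.trans hn⟩]
      exact downMask_and x _ _ hk'
  have hm := forallMasks_sound h1 h2 m 0 (by omega) (classifiedBelow_of_lt m.2)
  rw [Nat.zero_add, Bool.or_eq_true] at hm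
  -- The elements covered by z have distinct masks that are maximal among the first m, so there are
  -- more than two maximal masks.
  have hm' := hm.resolve_left fun h => by
    have h3 := Nat.le_of_ble_eq_true h
    refine absurd (hz.trans_le (ncard_setOf_le_length (downMask_injective x) _ fun w hw => ?_))
      h3.not_gt
    obtain ⟨i, rfl⟩ := x.surjective w
    rw [maximalMasks, List.mem_filter, List.all_eq_true]
    constructor
    · rw [← hd i]
      exact List.mem_map_of_mem (List.mem_range.2 (hx _ _ hw.lt))
    · intro b hb
      obtain ⟨j, hj, rfl⟩ := List.mem_map.1 hb
      rw [List.mem_range] at hj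
      have hj7 : j < 7 := hj.trans m.2
      rw [hd ⟨j, hj7⟩, Bool.or_eq_true, Bool.not_eq_true', ← Bool.not_eq_true, maskLE_downMask]
      by_cases hij : x i ≤ x ⟨j, hj7⟩
      · right
        have hjm : x ⟨j, hj7⟩ < x m := by
          refine lt_of_le_of_ne ((hxz _).2 hj.le) fun h => ?_
          rw [← x.injective h] at hj
          simp at hj
        rcases hij.eq_or_lt with h | h
        · rw [h]
          exact Nat.beq_refl _
        · exact absurd hjm (hw.2 h)
      · exact Or.inl hij
  -- The elements below z are exactly those at positions up to m.
  have hmask : downMask x (x m) = 2 ^ ((m : ℕ) + 1) - 1 := by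
    refine Nat.eq_of_testBit_eq fun i => ?_
    rw [Nat.testBit_two_pow_sub_one]
    rcases lt_or_ge i 7 with hi | hi
    · rw [Bool.eq_iff_iff, testBit_downMask x _ ⟨i, hi⟩, hxz, decide_eq_true_iff,
        Nat.lt_succ_iff]
      rfl
    · rw [testBit_downMask_of_le x _ hi, eq_comm, decide_eq_false_iff_not]
      omega
  have hsnoc : (List.range m).map d ++ [Nat.sub (Nat.pow 2 (Nat.succ m)) 1] =
      (List.range (m + 1)).map d := by
    rw [List.range_succ, List.map_append, List.map_singleton, hd m, hmask]
    rfl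
  rw [hsnoc] at hm'
  have hcl := forallMasks_sound h1 h2 (6 - m) (m + 1) (by omega) hm'
  obtain ⟨D, hD, q, hq, hne, hcov⟩ := exists_of_classified hcl
  have hq' : ∀ i, ∃ j, downMask x (x j) = q i := by
    intro i
    obtain ⟨j, hj, hji⟩ := List.mem_map.1 (hq i)
    rw [List.mem_range] at hj
    exact ⟨⟨j, by omega⟩, by rw [← hji, ← hd]⟩
  choose y hy using hq'
  have hle : ∀ i j, maskLE (q i) (q j) = true ↔ x (y i) ≤ x (y j) := by
    intro i j
    rw [← hy, ← hy, maskLE_downMask]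
  have hinj : Function.Injective y := by
    intro i j h
    by_contra hij
    refine hne i j hij ?_
    rw [hle, hle, h]
    exact ⟨le_rfl, le_rfl⟩
  let e : Fin 7 ≃ S := (Equiv.ofBijective y (Finite.injective_iff_bijective.1 hinj)).trans x
  have he : ∀ i, e i = x (y i) := fun _ => rfl
  have hlt : ∀ i j, e i < e j ↔ i ≠ j ∧ maskLE (q i) (q j) = true := by
    intro i j
    rw [hle, lt_iff_le_and_ne, ← he, ← he, and_comm, e.injective.ne_iff]
  refine ⟨D, hD, e, fun i j => ?_⟩
  rw [hcov i j, ← hlt]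
  refine and_congr_right fun _ => ?_
  constructor
  · intro h c hc hc'
    obtain ⟨k, rfl⟩ := e.surjective c
    have h3 := (hlt _ _).1 hc
    have h4 := (hlt _ _).1 hc'
    exact h k h3.1.symm h4.1 ⟨h3.2, h4.2⟩
  · rintro h k hki hkj ⟨h3, h4⟩
    exact h ((hlt i k).2 ⟨hki.symm, h3⟩) ((hlt k j).2 ⟨hkj, h4⟩)

/-- The easy half of the classification: some vertex covers at least three. Without repetitions the
list length is the number of covered elements. -/
theorem length_diagrams7 : ∀ D ∈ diagrams7, ∃ j, 2 < (D j).length ∧ (D j).Nodup := by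
  decide +kernel

theorem constructibleWith_two_iff (hS : InfClosed (S : Set P)) (hcard : S.card = 7) :
    ConstructibleWith 2 S ↔ ¬ InClasses diagrams7 S := by
  classical
  rw [constructibleWith_iff]
  constructor
  · rintro h ⟨D, hD, e, he⟩
    obtain ⟨j, hj, hnd⟩ := length_diagrams7 D hD
    have hset : {w : S | w ⋖ e j} = e '' ((D j).toFinset : Set (Fin 7)) := by
      ext w
      obtain ⟨i, rfl⟩ := e.surjective w
      simp [he i j]
    have := h (e j)
    rw [hset, Set.ncard_image_of_injective _ e.injective, Set.ncard_coe_finset,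
      List.toFinset_card_of_nodup hnd] at this
    omega
  · intro h z
    by_contra hz
    exact h (inClasses_of_covers_three hS hcard (not_le.1 hz))

end Classification

end JoinMatrix

theorem mainTheorem2 {P : Type*} [Lattice P] [DecidableEq P] (S : Finset P)
    (hS : InfClosed (S : Set P)) (hcard : S.card = 7) :
    (ConstructibleWith 2 S ↔ ¬ InClasses diagrams7 S) ∧
    (¬ InClasses diagrams7 S →
      ∀ f ∈ classFk P 2, IsUnit (joinMatrix S f)) ∧
    (InClasses diagrams7A S →
      ∀ f ∈ classFk P 1 ∩ classG P diagramS35,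
        IsUnit (joinMatrix S f)) ∧
    (InClasses diagrams7B S →
      ∀ f ∈ classFk P 1 ∩ classG P diagramS36,
        IsUnit (joinMatrix S f)) ∧
    (InClasses diagrams7C S →
      ∀ f ∈ classFk P 2 ∩ classG P diagramS35,
        IsUnit (joinMatrix S f)) ∧
    (InClasses diagrams7D S →
      ∀ f ∈ classFk P 1 ∩ classG P diagramS46,
        IsUnit (joinMatrix S f)) ∧
    (InClasses diagrams7E S →
      ∀ f ∈ classFk P 2 ∩ classG P diagramS36,
        IsUnit (joinMatrix S f)) ∧
    (InClasses diagrams7F S →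
      ∀ f ∈ classFk P 2 ∩ classG P diagramS37,
        IsUnit (joinMatrix S f)) ∧
    (InClasses diagrams7G S →
      ∀ f ∈ classFk P 1 ∩ classG P diagramS47one,
        IsUnit (joinMatrix S f)) ∧
    (InClasses diagrams7H S →
      ∀ f ∈ classFk P 1 ∩ classG P diagramS47two,
        IsUnit (joinMatrix S f)) ∧
    (InClasses diagrams7I S →
      ∀ f ∈ classFk P 1 ∩ classG P diagramS57,
        IsUnit (joinMatrix S f)) := by
  refine ⟨constructibleWith_two_iff hS hcard, fun h f hf => ?_, fun h f hf => ?_,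
    fun h f hf => ?_, fun h f hf => ?_, fun h f hf => ?_, fun h f hf => ?_, fun h f hf => ?_,
    fun h f hf => ?_, fun h f hf => ?_, fun h f hf => ?_⟩
  · exact isUnit_joinMatrix hS hf.1 (recipConv_ne_zero_of_mem_classFk hf hS
      ((constructibleWith_iff 2 S).1 ((constructibleWith_two_iff hS hcard).2 h)))
  · exact isUnit_joinMatrix_of_inClasses (Or.inl rfl) (fun D hD =>
      (subdiagram_diagrams7A D hD).imp_right fun H v => (H v).imp_right
        fun ⟨_, hφ⟩ => ⟨_, hφ⟩) hS h hf
  · exact isUnit_joinMatrix_of_inClasses (Or.inl rfl) (fun D hD =>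
      (subdiagram_diagrams7B D hD).imp_right fun H v => (H v).imp_right
        fun ⟨_, _, _, hφ⟩ => ⟨_, hφ⟩) hS h hf
  · exact isUnit_joinMatrix_of_inClasses (Or.inr rfl) (fun D hD =>
      (subdiagram_diagrams7C D hD).imp_right fun H v => (H v).imp_right
        fun ⟨_, hφ⟩ => ⟨_, hφ⟩) hS h hf
  · exact isUnit_joinMatrix_of_inClasses (Or.inl rfl) (fun D hD =>
      (subdiagram_diagrams7D D hD).imp_right fun H v => (H v).imp_right
        fun ⟨_, hφ⟩ => ⟨_, hφ⟩) hS h hf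
  · exact isUnit_joinMatrix_of_inClasses (Or.inr rfl) (fun D hD =>
      (subdiagram_diagrams7E D hD).imp_right fun H v => (H v).imp_right
        fun ⟨_, _, hφ⟩ => ⟨_, hφ⟩) hS h hf
  · exact isUnit_joinMatrix_of_inClasses (Or.inr rfl) (fun D hD =>
      (subdiagram_diagrams7F D hD).imp_right fun H v => (H v).imp_right
        fun hφ => ⟨_, hφ⟩) hS h hf
  · exact isUnit_joinMatrix_of_inClasses (Or.inl rfl) (fun D hD =>
      (subdiagram_diagrams7G D hD).imp_right fun H v => (H v).imp_right
        fun hφ => ⟨_, hφ⟩) hS h hf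
  · exact isUnit_joinMatrix_of_inClasses (Or.inl rfl) (fun D hD =>
      (subdiagram_diagrams7H D hD).imp_right fun H v => (H v).imp_right
        fun hφ => ⟨_, hφ⟩) hS h hf
  · exact isUnit_joinMatrix_of_inClasses (Or.inl rfl) (fun D hD =>
      (subdiagram_diagrams7I D hD).imp_right fun H v => (H v).imp_right
        fun hφ => ⟨_, hφ⟩) hS h hf
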